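/- Let $\mathbb D\subset\mathbb C$ be the open unit disc. For a domain $D$ in a finite-dimensional complex vector space $E$, $z,w\in D$ and $X\in E$, put $$l_D(z,w)=\inf\{|\alpha|:\alpha\in\mathbb D,\ \exists\,\varphi\in\mathcal O(\mathbb D,D):\varphi(0)=z,\ \varphi(\alpha)=w\},$$ $$\kappa_D(z;X)=\inf\{|\alpha|:\alpha\in\mathbb C,\ \exists\,\varphi\in\mathcal O(\mathbb D,D):\varphi(0)=z,\ \alpha\varphi'(0)=X\},$$ $$\mathcal D l_D(z;X)=\limsup_{\mathbb C\setminus\{0\}\ni t\to0,\ z'\to z,\ X'\to X}\frac{l_D(z',z'+tX')}{|t|}$$ (with $z'\in D$, $X'\in E$). Let $\Omega_3$ be the spectral unit ball, that is, the set of complex $3\times3$ matrices all of whose eigenvalues lie in $\mathbb D$, regarded as a domain in $\mathbb C^9$, and let $\widetilde\Omega_3$ be the set of all traceless matrices in $\Omega_3$, regarded as a domain in the $8$-dimensional space of traceless matrices. Let $\omega=e^{2\pi i/3}$, $$A=\begin{pmatrix}0&0&0\\0&0&1\\0&0&0\end{pmatrix},\qquad B_t=\begin{pmatrix}1&0&0\\0&\omega&0\\0&3t&\omega^2\end{pmatrix}\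 (t\in\mathbb C),\qquad B=B_0.$$ Then the following limit exists, and $$1=\kappa_{\widetilde\Omega_3}(A;B)=\lim_{\mathbb C\setminus\{0\}\ni t\to0}\frac{l_{\Omega_3}(A,A+tB_t)}{|t|}.$$ Moreover, $$\kappa_{\widetilde\Omega_3}(A;B)=\kappa_{\Omega_3}(A;B)=\mathcal D l_{\widetilde\Omega_3}(A;B)=\mathcal D l_{\Omega_3}(A;B)=1.$$ -/

import Mathlib

open Filter Topology Metric

open scoped ENNReal

-- The norm on matrices only serves to provide the usual topology of `ℂ⁹` (all norms are equivalent).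
attribute [local instance] Matrix.normedAddCommGroup Matrix.normedSpace

noncomputable section

section Invariants

variable {E : Type*} [NormedAddCommGroup E] [NormedSpace ℂ E]

/-- `φ` is (on the open unit disc) a holomorphic map from the unit disc into `D`. -/
def IsHolomorphicDisc (D : Set E) (φ : ℂ → E) : Prop :=
  DifferentiableOn ℂ φ (ball 0 1) ∧ Set.MapsTo φ (ball 0 1) D

/-- The Lempert function of `D`: the infimum (in `[0, ∞]`) of `|α|` over all `α` in the unit disc
for which there is a holomorphic disc `φ` in `D` with `φ 0 = z` and `φ α = w`. -/
def lempertFunction (D : Set E) (z w : E) : ℝ≥0∞ :=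
  sInf {r | ∃ α : ℂ, α ∈ ball (0 : ℂ) 1 ∧ r = ‖α‖ₑ ∧
    ∃ φ : ℂ → E, IsHolomorphicDisc D φ ∧ φ 0 = z ∧ φ α = w}

/-- The Kobayashi-Royden pseudometric of `D`: the infimum (in `[0, ∞]`) of `|α|` over all complex
`α` for which there is a holomorphic disc `φ` in `D` with `φ 0 = z` and `α φ'(0) = X`. -/
def kobayashiRoyden (D : Set E) (z X : E) : ℝ≥0∞ :=
  sInf {r | ∃ α : ℂ, r = ‖α‖ₑ ∧
    ∃ φ : ℂ → E, IsHolomorphicDisc D φ ∧ φ 0 = z ∧ α • deriv φ 0 = X}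

/-- The derivative of the Lempert function of an open set `D` at `z ∈ D` in direction `X`:
the upper limit of `l_D(z', z' + t X') / |t|` as `t → 0` (`t ≠ 0`), `z' → z`, `X' → X`. -/
def lempertDerivative (D : Set E) (z X : E) : ℝ≥0∞ :=
  limsup (fun p : ℂ × E × E => lempertFunction D p.2.1 (p.2.1 + p.1 • p.2.2) / ‖p.1‖ₑ)
    (𝓝[≠] (0 : ℂ) ×ˢ (𝓝 z ×ˢ 𝓝 X))

end Invariants

/-- The spectral unit ball `Ω₃`: the complex `3 × 3` matrices all of whose eigenvalues lie in the
open unit disc. -/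
def spectralBall : Set (Matrix (Fin 3) (Fin 3) ℂ) :=
  {M | spectrum ℂ M ⊆ ball 0 1}

/-- The eight-dimensional space of traceless complex `3 × 3` matrices. -/
abbrev TracelessMatrix : Submodule ℂ (Matrix (Fin 3) (Fin 3) ℂ) :=
  LinearMap.ker (Matrix.traceLinearMap (Fin 3) ℂ ℂ)

/-- The traceless part of the spectral unit ball, as a subset of the space of traceless matrices. -/
def tracelessSpectralBall : Set TracelessMatrix :=
  {M | (M : Matrix (Fin 3) (Fin 3) ℂ) ∈ spectralBall}

/-- The primitive cube root of unity `exp(2πi/3)`. -/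
def cubeRoot : ℂ := Complex.exp (2 * Real.pi * Complex.I / 3)

/-- The matrix `A`. -/
def matA : Matrix (Fin 3) (Fin 3) ℂ := !![0, 0, 0; 0, 0, 1; 0, 0, 0]

/-- The matrix `B_t`. -/
def matB (t : ℂ) : Matrix (Fin 3) (Fin 3) ℂ :=
  !![1, 0, 0; 0, cubeRoot, 0; 0, 3 * t, cubeRoot ^ 2]

theorem matA_traceless : matA ∈ TracelessMatrix := by
  simp [matA, Matrix.trace_fin_three]

theorem matB_traceless (t : ℂ) : matB t ∈ TracelessMatrix := by
  have h : IsPrimitiveRoot cubeRoot 3 := by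
    simpa [cubeRoot] using Complex.isPrimitiveRoot_exp 3 (by norm_num)
  have h2 := h.geom_sum_eq_zero (by norm_num)
  simpa [matB, Matrix.trace_fin_three, Finset.sum_range_succ] using h2

/-- The matrix `A`, as an element of the space of traceless matrices. -/
def tracelessA : TracelessMatrix := ⟨matA, matA_traceless⟩

/-- The matrix `B = B_0`, as an element of the space of traceless matrices. -/
def tracelessB : TracelessMatrix := ⟨matB 0, matB_traceless 0⟩

end

/-!
Let `φ` be a holomorphic map from the unit disc into the spectral unit ball of `n × n` matrices.
For `|w| < 1` the function `z ↦ det (z - w φ(z))` has exactly `n` zeros in the disc: it has none on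
`|z| = r` when `|w| ≤ r < 1`, because the eigenvalues of `φ(z)` lie in the disc, so deforming `w` to
`0` turns it into `z ^ n` without changing the number of zeros in `|z| < r`. On the other hand it
vanishes at each point `z` to order at least the corank of `z - w φ(z)`.

The matrix `A` has rank one, and so has `t - (A + t B_t)`: the eigenvalue `t` of `A + t B_t` has
geometric multiplicity two. If `φ(0) = A` and `φ(α) = A + t B_t` with `|α| < |t|`, then taking
`w = α / t` gives coranks `2` at both `0` and `α`, contradicting `2 + 2 > 3`. Hence
`l(A, A + t B_t) ≥ |t|`. Conversely `κ(A; B) ≤ 1` by the linear disc `ζ ↦ A + ζ B`, and the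
derivative of the Lempert function is at most `κ` because a disc that is slightly shrunk may be
perturbed by affine maps without leaving an open set.
-/

section ArgumentPrinciple

open MeromorphicOn

theorem preperfect_closedBall {E : Type*} [NormedAddCommGroup E] [NormedSpace ℝ E] [Nontrivial E]
    (c : E) {r : ℝ} (hr : 0 < r) : Preperfect (closedBall c r) := by
  rw [← closure_ball c hr.ne']
  exact isOpen_ball.preperfect.perfect_closure.acc

section NontriviallyNormedField

variable {𝕜 : Type*} [NontriviallyNormedField 𝕜]

theorem support_divisor_closedBall_subset_ball {c : 𝕜} {r : ℝ} {f : 𝕜 → 𝕜}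
    (hf : MeromorphicOn f (closedBall c r))
    (h0 : ∀ z ∈ sphere c r, meromorphicOrderAt f z = 0) :
    (divisor f (closedBall c r)).support ⊆ ball c r := by
  intro u hu
  have hu' : u ∈ ball c r ∪ sphere c r := by
    rw [ball_union_sphere]
    exact (divisor f (closedBall c r)).supportWithinDomain hu
  refine hu'.resolve_right fun h => hu ?_
  rw [divisor_apply hf (sphere_subset_closedBall h), h0 u h, WithTop.untop₀_zero]

theorem sum_divisor_le_finsum {U : Set 𝕜} (hU : IsCompact U) {f : 𝕜 → 𝕜}
    (hf : AnalyticOnNhd 𝕜 f U) (s : Finset 𝕜) : ∑ u ∈ s, divisor f U u ≤ ∑ᶠ u, divisor f U u := by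
  classical
  rw [finsum_eq_sum_of_support_subset (s := ((divisor f U).finiteSupport hU).toFinset ∪ s) _
    (by simp)]
  exact Finset.sum_le_sum_of_subset_of_nonneg Finset.subset_union_right
    fun u _ _ => AnalyticOnNhd.divisor_nonneg hf u

theorem logDeriv_finprod_sub_zpow {d : 𝕜 → ℤ} {z : 𝕜} (hd : d.support.Finite) (hz : d z = 0) :
    logDeriv (∏ᶠ u, (· - u) ^ d u) z = ∑ᶠ u, (d u : 𝕜) * (z - u)⁻¹ := by
  have hsupp : ∀ u, u ∈ hd.toFinset ↔ d u ≠ 0 := fun u => hd.mem_toFinset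
  have hzu : ∀ u ∈ hd.toFinset, z - u ≠ 0 := fun u hu h =>
    (hsupp u).1 hu (sub_eq_zero.1 h ▸ hz)
  have hprod : (∏ᶠ u, (· - u) ^ d u) = fun x : 𝕜 => ∏ u ∈ hd.toFinset, (x - u) ^ d u := by
    rw [finprod_eq_prod_of_mulSupport_subset (s := hd.toFinset) _
      (by rw [Function.FactorizedRational.mulSupport, Set.Finite.coe_toFinset])]
    exact Finset.prod_fn _ _
  rw [hprod, logDeriv_prod (f := fun u x => (x - u) ^ d u)
      (fun u hu => zpow_ne_zero _ (hzu u hu))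
      fun u hu => (differentiableAt_id.sub_const u).zpow (Or.inl (hzu u hu)),
    finsum_eq_sum_of_support_subset (s := hd.toFinset)]
  · refine Finset.sum_congr rfl fun u _ => ?_
    rw [logDeriv_fun_zpow (by fun_prop), logDeriv_apply, deriv_sub_const, deriv_id'', one_div]
  · intro u hu
    exact (hsupp u).2 fun h => hu (by simp [h])

theorem exists_logDeriv_eventuallyEq_finsum_divisor {f : 𝕜 → 𝕜} {U : Set 𝕜}
    (hU : IsCompact U) (hU' : Preperfect U) (hf : MeromorphicOn f U)
    (hf' : ∀ z ∈ U, meromorphicOrderAt f z ≠ ⊤) :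
    ∃ g : 𝕜 → 𝕜, AnalyticOnNhd 𝕜 g U ∧ (∀ z ∈ U, g z ≠ 0) ∧
      logDeriv f =ᶠ[codiscreteWithin U]
        fun z => ∑ᶠ u, (divisor f U u : 𝕜) * (z - u)⁻¹ + logDeriv g z := by
  have hD : (divisor f U).support.Finite := (divisor f U).finiteSupport hU
  obtain ⟨g, hg, hg0, hfg⟩ := hf.extract_zeros_poles (fun z => hf' z z.2) hD
  set P : 𝕜 → 𝕜 := ∏ᶠ u, (· - u) ^ divisor f U u
  have hlog : logDeriv f =ᶠ[codiscreteWithin U] logDeriv (P • g) := by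
    refine mem_codiscreteWithin_iff_forall_mem_nhdsNE.2 fun z hz => ?_
    have hP : MeromorphicAt P z :=
      (Function.FactorizedRational.meromorphicNFOn _ U).meromorphicOn z hz
    exact mem_of_superset (logDeriv_congr_nhdsNE
      ((hf z hz).eventuallyEq_nhdsNE_of_eventuallyEq_codiscreteWithin_preperfect
        (hP.smul (hg z hz).meromorphicAt) hz hU' hfg)) Set.subset_union_left
  refine ⟨g, hg, fun z hz => hg0 ⟨z, hz⟩, ?_⟩
  filter_upwards [hlog, (divisor f U).eq_zero_codiscreteWithin, self_mem_codiscreteWithin U]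
    with z hz hDz hzU
  rw [hz, ← logDeriv_finprod_sub_zpow hD hDz]
  exact logDeriv_mul z (Function.FactorizedRational.ne_zero hDz) (hg0 ⟨z, hzU⟩)
    (Function.FactorizedRational.analyticAt hDz.ge).differentiableAt (hg z hzU).differentiableAt

end NontriviallyNormedField

variable {c : ℂ} {r : ℝ} {f : ℂ → ℂ}

theorem circleIntegral_logDeriv_eq_zero (hr : 0 ≤ r) (hf : AnalyticOnNhd ℂ f (closedBall c r))
    (h0 : ∀ z ∈ closedBall c r, f z ≠ 0) : (∮ z in C(c, r), logDeriv f z) = 0 := by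
  have hlog : AnalyticOnNhd ℂ (logDeriv f) (closedBall c r) := hf.deriv.div hf h0
  exact Complex.circleIntegral_eq_zero_of_differentiable_on_off_countable hr Set.countable_empty
    hlog.continuousOn fun z hz => (hlog z (ball_subset_closedBall hz.1)).differentiableAt

theorem circleIntegrable_mul_sub_inv {u : ℂ} (hu : u ∈ ball c r) (a : ℂ) :
    CircleIntegrable (fun z => a * (z - u)⁻¹) c r := by
  refine IntervalIntegrable.const_mul (circleIntegrable_sub_inv_iff.2 (Or.inr fun h => ?_)) a
  rw [abs_of_pos (pos_of_mem_ball hu)] at h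
  exact (mem_ball.1 hu).ne (mem_sphere.1 h)

theorem circleIntegral_sum_mul_sub_inv {s : Finset ℂ} (hs : ↑s ⊆ ball c r) (a : ℂ → ℂ) :
    (∮ z in C(c, r), ∑ u ∈ s, a u * (z - u)⁻¹) = (∑ u ∈ s, a u) * (2 * Real.pi * Complex.I) := by
  rw [circleIntegral.integral_fun_sum fun u hu => circleIntegrable_mul_sub_inv (hs hu) _,
    Finset.sum_mul]
  refine Finset.sum_congr rfl fun u hu => ?_
  rw [circleIntegral.integral_const_mul, circleIntegral.integral_sub_inv_of_mem_ball (hs hu)]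

theorem circleIntegral_logDeriv_eq_finsum_divisor (hr : 0 < r)
    (hf : MeromorphicOn f (closedBall c r))
    (h0 : ∀ z ∈ sphere c r, meromorphicOrderAt f z = 0) :
    (∮ z in C(c, r), logDeriv f z) =
      (∑ᶠ u, divisor f (closedBall c r) u : ℤ) * (2 * Real.pi * Complex.I) := by
  set D := divisor f (closedBall c r)
  have hfin : D.support.Finite := D.finiteSupport (isCompact_closedBall c r)
  have hball : ↑hfin.toFinset ⊆ ball c r := by
    rw [hfin.coe_toFinset]
    exact support_divisor_closedBall_subset_ball hf h0
  obtain ⟨w, hw⟩ := NormedSpace.sphere_nonempty (x := c).2 hr.le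
  obtain ⟨g, hg, hg0, hfg⟩ := exists_logDeriv_eventuallyEq_finsum_divisor
    (isCompact_closedBall c r) (preperfect_closedBall c hr) hf fun z hz =>
      hf.meromorphicOrderAt_ne_top_of_isPreconnected (convex_closedBall c r).isPreconnected
        (sphere_subset_closedBall hw) hz (by simp [h0 w hw])
  have hsum : ∀ z, ∑ᶠ u, (D u : ℂ) * (z - u)⁻¹ = ∑ u ∈ hfin.toFinset, (D u : ℂ) * (z - u)⁻¹ :=
    fun z => finsum_eq_sum_of_support_subset _ fun u hu => by
      simpa using left_ne_zero_of_mul hu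
  have hintg : CircleIntegrable (logDeriv g) c r :=
    ((hg.deriv.div hg hg0).continuousOn.mono sphere_subset_closedBall).circleIntegrable hr.le
  calc (∮ z in C(c, r), logDeriv f z)
      = ∮ z in C(c, r), (∑ u ∈ hfin.toFinset, (D u : ℂ) * (z - u)⁻¹ + logDeriv g z) := by
        refine circleIntegral.circleIntegral_congr_codiscreteWithin ?_ hr.ne'
        simp only [← hsum, abs_of_pos hr]
        exact hfg.filter_mono (codiscreteWithin_mono sphere_subset_closedBall)
    _ = (∑ u ∈ hfin.toFinset, (D u : ℂ)) * (2 * Real.pi * Complex.I) := by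
        rw [circleIntegral.integral_add
            (.fun_sum _ fun u hu => circleIntegrable_mul_sub_inv (hball hu) _) hintg,
          circleIntegral_logDeriv_eq_zero hr.le hg hg0, add_zero,
          circleIntegral_sum_mul_sub_inv hball]
    _ = (∑ᶠ u, D u : ℤ) * (2 * Real.pi * Complex.I) := by
        rw [finsum_eq_sum _ hfin, Int.cast_sum]

theorem sum_analyticOrderAt_le_of_circleIntegral_logDeriv_eq (hr : 0 < r)
    (hf : AnalyticOnNhd ℂ f (closedBall c r)) (h0 : ∀ z ∈ sphere c r, f z ≠ 0) {N : ℕ}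
    (hN : (∮ z in C(c, r), logDeriv f z) = N * (2 * Real.pi * Complex.I))
    {s : Finset ℂ} (hs : ↑s ⊆ closedBall c r) : ∑ u ∈ s, analyticOrderAt f u ≤ N := by
  obtain ⟨w, hw⟩ := NormedSpace.sphere_nonempty (x := c).2 hr.le
  have hord : ∀ z ∈ sphere c r, analyticOrderAt f z = 0 := fun z hz =>
    (hf z (sphere_subset_closedBall hz)).analyticOrderAt_eq_zero.2 (h0 z hz)
  have htop : ∀ u ∈ s, analyticOrderAt f u ≠ ⊤ := fun u hu =>
    hf.analyticOrderAt_ne_top_of_isPreconnected (convex_closedBall c r).isPreconnected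
      (sphere_subset_closedBall hw) (hs hu) (by simp [hord w hw])
  have hD : ∀ u ∈ s, divisor f (closedBall c r) u = analyticOrderNatAt f u := fun u hu => by
    rw [AnalyticOnNhd.divisor_apply hf (hs hu), ← Nat.cast_analyticOrderNatAt (htop u hu)]
    simp
  have hNat : ∑ u ∈ s, analyticOrderNatAt f u ≤ N := by
    rw [circleIntegral_logDeriv_eq_finsum_divisor hr hf.meromorphicOn fun z hz => by
      simp [(hf z (sphere_subset_closedBall hz)).meromorphicOrderAt_eq, hord z hz]] at hN
    have hcount : ∑ᶠ u, divisor f (closedBall c r) u = N := by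
      exact_mod_cast mul_right_cancel₀ Complex.two_pi_I_ne_zero hN
    zify
    rw [← hcount, ← Finset.sum_congr rfl hD]
    exact sum_divisor_le_finsum (isCompact_closedBall c r) hf s
  rw [← Finset.sum_congr rfl fun u hu => Nat.cast_analyticOrderNatAt (htop u hu)]
  exact_mod_cast hNat

end ArgumentPrinciple

section Homotopy

variable {X : Type*} [TopologicalSpace X]

theorem tendstoLocallyUniformlyOn_of_continuousOn_uncurry {α β : Type*} [TopologicalSpace α]
    [UniformSpace β] {F : X → α → β} {U : Set α} (hF : ContinuousOn F.uncurry (Set.univ ×ˢ U))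
    (x : X) : TendstoLocallyUniformlyOn F (F x) (𝓝 x) U := by
  rw [tendstoLocallyUniformlyOn_iff_forall_tendsto]
  intro z hz
  have hFz : Tendsto F.uncurry (𝓝 x ×ˢ 𝓝[U] z) (𝓝 (F x z)) := by
    rw [← nhdsWithin_univ, ← nhdsWithin_prod_eq]
    exact hF (x, z) ⟨trivial, hz⟩
  have hFxz : Tendsto (fun p : X × α => F x p.2) (𝓝 x ×ˢ 𝓝[U] z) (𝓝 (F x z)) :=
    hFz.comp ((tendsto_const_nhds (x := x)).prodMk tendsto_snd)
  exact (hFxz.prodMk hFz).mono_right (nhds_prod_eq.symm.trans_le (nhds_le_uniformity _))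

variable {E : Type*} [NormedAddCommGroup E] [NormedSpace ℂ E]

theorem continuousOn_uncurry_deriv [CompleteSpace E] {F : X → ℂ → E} {U : Set ℂ} (hU : IsOpen U)
    (hF : ContinuousOn F.uncurry (Set.univ ×ˢ U)) (hd : ∀ x, DifferentiableOn ℂ (F x) U) :
    ContinuousOn (Function.uncurry fun x => deriv (F x)) (Set.univ ×ˢ U) := by
  rintro ⟨x, z⟩ ⟨-, hz⟩
  have hderiv : TendstoLocallyUniformlyOn (deriv ∘ F) (deriv (F x)) (𝓝 x) U :=
    (tendstoLocallyUniformlyOn_of_continuousOn_uncurry hF x).deriv (.of_forall hd) hU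
  have hcont : Tendsto (deriv (F x)) (𝓝[U] z) (𝓝 (deriv (F x) z)) :=
    ((hd x).deriv hU).continuousOn z hz
  rw [ContinuousWithinAt, nhdsWithin_prod_eq, nhdsWithin_univ]
  exact (hcont.comp tendsto_snd).congr_uniformity
    (tendstoLocallyUniformlyOn_iff_forall_tendsto.1 hderiv z hz)

theorem continuous_circleIntegral {F : X → ℂ → E} {c : ℂ} {r : ℝ} (hr : 0 ≤ r)
    (hF : ContinuousOn F.uncurry (Set.univ ×ˢ sphere c r)) :
    Continuous fun x => ∮ z in C(c, r), F x z := by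
  have hcircle : Continuous fun p : X × ℝ => F.uncurry (p.1, circleMap c r p.2) :=
    hF.comp_continuous (by fun_prop) fun p => ⟨trivial, circleMap_mem_sphere c hr p.2⟩
  have hderiv : Continuous fun p : X × ℝ => deriv (circleMap c r) p.2 := by
    simp only [deriv_circleMap]
    fun_prop
  exact intervalIntegral.continuous_parametric_intervalIntegral_of_continuous'
    (hderiv.smul hcircle) 0 (2 * Real.pi)

theorem circleIntegral_logDeriv_eq_of_preconnectedSpace [PreconnectedSpace X] {F : X → ℂ → ℂ}
    {U : Set ℂ} {c : ℂ} {r : ℝ} (hr : 0 < r) (hU : IsOpen U) (hrU : closedBall c r ⊆ U)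
    (hF : ContinuousOn F.uncurry (Set.univ ×ˢ U)) (hd : ∀ x, DifferentiableOn ℂ (F x) U)
    (h0 : ∀ x, ∀ z ∈ sphere c r, F x z ≠ 0) (x y : X) :
    (∮ z in C(c, r), logDeriv (F x) z) = ∮ z in C(c, r), logDeriv (F y) z := by
  have hcont : Continuous fun x => ∮ z in C(c, r), logDeriv (F x) z := by
    have hsub : Set.univ ×ˢ sphere c r ⊆ (Set.univ ×ˢ U : Set (X × ℂ)) :=
      Set.prod_mono_right (sphere_subset_closedBall.trans hrU)
    exact continuous_circleIntegral hr.le (((continuousOn_uncurry_deriv hU hF hd).mono hsub).div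
      (hF.mono hsub) fun p hp => h0 p.1 p.2 hp.2)
  have hint : ∀ x, ∃ k : ℤ,
      (∮ z in C(c, r), logDeriv (F x) z) = k * (2 * Real.pi * Complex.I) := fun x => by
    have hFx : AnalyticOnNhd ℂ (F x) (closedBall c r) := ((hd x).analyticOnNhd hU).mono hrU
    refine ⟨_, circleIntegral_logDeriv_eq_finsum_divisor hr hFx.meromorphicOn fun z hz => ?_⟩
    have hz' := hFx z (sphere_subset_closedBall hz)
    simp [hz'.meromorphicOrderAt_eq, hz'.analyticOrderAt_eq_zero.2 (h0 x z hz)]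
  choose k hk using hint
  have hkcont : Continuous k := by
    rw [Int.isClosedEmbedding_coe_real.continuous_iff]
    have hre : ((↑) : ℤ → ℝ) ∘ k =
        fun x => ((∮ z in C(c, r), logDeriv (F x) z) / (2 * Real.pi * Complex.I)).re := by
      funext x
      simp [hk]
    rw [hre]
    exact Complex.continuous_re.comp (hcont.div_const _)
  rw [hk, hk, PreconnectedSpace.constant ‹_› hkcont]

end Homotopy

section Determinant

variable {𝕜 : Type*} [NontriviallyNormedField 𝕜] {n : Type*} [Fintype n]

theorem analyticAt_matrix_iff {E : Type*} [NormedAddCommGroup E] [NormedSpace 𝕜 E]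
    {m : Type*} [Fintype m] {M : E → Matrix m n 𝕜} {c : E} :
    AnalyticAt 𝕜 M c ↔ ∀ i j, AnalyticAt 𝕜 (fun z => M z i j) c :=
  analyticAt_pi_iff.trans (forall_congr' fun _ => analyticAt_pi_iff)

variable [DecidableEq n]

theorem analyticAt_det {E : Type*} [NormedAddCommGroup E] [NormedSpace 𝕜 E]
    {M : E → Matrix n n 𝕜} {c : E} (hM : AnalyticAt 𝕜 M c) :
    AnalyticAt 𝕜 (fun z => (M z).det) c := by
  have hM' := analyticAt_matrix_iff.1 hM
  simp only [Matrix.det_apply']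
  fun_prop

theorem analyticAt_dslope {f : 𝕜 → 𝕜} {c : 𝕜} (hf : AnalyticAt 𝕜 f c) :
    AnalyticAt 𝕜 (dslope f c) c :=
  let ⟨_, hp⟩ := hf
  hp.has_fpower_series_dslope_fslope.analyticAt

theorem card_le_analyticOrderAt_det {M : 𝕜 → Matrix n n 𝕜} {c : 𝕜} (hM : AnalyticAt 𝕜 M c)
    {s : Finset n} (hs : ∀ i ∈ s, M c i = 0) :
    s.card ≤ analyticOrderAt (fun z => (M z).det) c := by
  let N : 𝕜 → Matrix n n 𝕜 := fun z => Matrix.of fun i j =>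
    if i ∈ s then dslope (fun z => M z i j) c z else M z i j
  have hN : AnalyticAt 𝕜 N c := analyticAt_matrix_iff.2 fun i j => by
    have hMij := analyticAt_matrix_iff.1 hM i j
    by_cases hi : i ∈ s <;> simp only [N, Matrix.of_apply, hi, if_true, if_false]
    exacts [analyticAt_dslope hMij, hMij]
  refine (natCast_le_analyticOrderAt (analyticAt_det hM)).2
    ⟨fun z => (N z).det, analyticAt_det hN, .of_forall fun z => ?_⟩
  have hMN : M z = Matrix.of fun i j => (if i ∈ s then z - c else 1) * N z i j := by
    ext i j
    by_cases hi : i ∈ s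
    · have hij : M c i j = 0 := congrFun (hs i hi) j
      simpa [N, hi, hij] using (sub_smul_dslope (fun z => M z i j) c z).symm
    · simp [N, hi]
  rw [hMN, Matrix.det_mul_column, Finset.prod_ite_mem, Finset.univ_inter, Finset.prod_const,
    smul_eq_mul]

theorem card_sub_rank_le_analyticOrderAt_det {M : 𝕜 → Matrix n n 𝕜} {c : 𝕜}
    (hM : AnalyticAt 𝕜 M c) :
    (Fintype.card n - (M c).rank : ℕ) ≤ analyticOrderAt (fun z => (M z).det) c := by
  obtain ⟨V, U, e, hV, hU, hVMU⟩ := (M c).exists_rank_normal_form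
  let s : Finset n := Finset.univ.map (Function.Embedding.inr.trans e.symm.toEmbedding)
  have hs : s.card = Fintype.card n - (M c).rank := by simp [s]
  have hrow : ∀ i ∈ s, (V * M c * U) i = 0 := by
    intro i hi
    obtain ⟨k, -, rfl⟩ := Finset.mem_map.1 hi
    ext j
    rw [hVMU, Matrix.submatrix_apply]
    cases e j <;> simp
  have hVMU' : AnalyticAt 𝕜 (fun z => V * M z * U) c := by
    have hM' := analyticAt_matrix_iff.1 hM
    refine analyticAt_matrix_iff.2 fun i j => ?_
    simp only [Matrix.mul_apply]
    fun_prop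
  have hdet : (fun z => (V * M z * U).det) = (fun _ => V.det * U.det) * fun z => (M z).det := by
    funext z
    rw [Matrix.det_mul, Matrix.det_mul, Pi.mul_apply]
    ring
  have hVU : V.det * U.det ≠ 0 :=
    mul_ne_zero ((Matrix.isUnit_iff_isUnit_det V).1 hV).ne_zero
      ((Matrix.isUnit_iff_isUnit_det U).1 hU).ne_zero
  calc ((Fintype.card n - (M c).rank : ℕ) : ℕ∞)
      ≤ analyticOrderAt (fun z => (V * M z * U).det) c :=
        hs ▸ card_le_analyticOrderAt_det hVMU' hrow
    _ = analyticOrderAt (fun z => (M z).det) c := by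
      rw [hdet, analyticOrderAt_mul analyticAt_const (analyticAt_det hM),
        analyticAt_const.analyticOrderAt_eq_zero.2 hVU, zero_add]

theorem matrix_rank_add_le {K m n : Type*} [Field K] [Fintype n] (M N : Matrix m n K) :
    (M + N).rank ≤ M.rank + N.rank := by
  have hrank := LinearMap.rank_add_le M.mulVecLin N.mulVecLin
  rw [← Matrix.mulVecLin_add] at hrank
  simp only [LinearMap.rank, ← Module.finrank_eq_rank] at hrank
  exact_mod_cast hrank

end Determinant

section Pencil

variable {n : Type*} [Fintype n] [DecidableEq n]

theorem det_smul_one_sub_smul_ne_zero {𝕜 : Type*} [NormedField 𝕜] {M : Matrix n n 𝕜}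
    (hM : spectrum 𝕜 M ⊆ ball 0 1) {w z : 𝕜} (hz : z ≠ 0) (hw : ‖w‖ ≤ ‖z‖) :
    (z • (1 : Matrix n n 𝕜) - w • M).det ≠ 0 := by
  rcases eq_or_ne w 0 with rfl | hw0
  · simp [hz]
  have hzw : z / w ∉ spectrum 𝕜 M := fun h => by
    have hlt := mem_ball_zero_iff.1 (hM h)
    rw [norm_div, div_lt_one (norm_pos_iff.2 hw0)] at hlt
    exact hlt.not_ge hw
  have hunit : IsUnit ((z / w) • (1 : Matrix n n 𝕜) - M) := by
    rwa [← Algebra.algebraMap_eq_smul_one, ← spectrum.notMem_iff]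
  have hfactor : z • (1 : Matrix n n 𝕜) - w • M = w • ((z / w) • 1 - M) := by
    rw [smul_sub, smul_smul, mul_div_cancel₀ _ hw0]
  rw [hfactor, Matrix.det_smul]
  exact mul_ne_zero (pow_ne_zero _ hw0) ((Matrix.isUnit_iff_isUnit_det _).1 hunit).ne_zero

/-- The matrix `z - w φ(z)`, for a matrix-valued function `φ`. As `w` moves from `0` to a given
point of the unit disc, its determinant deforms `z ^ n` into a function whose zeros detect the
points `z` at which `z / w` is an eigenvalue of `φ z`. -/
def pencil (φ : ℂ → Matrix n n ℂ) (w z : ℂ) : Matrix n n ℂ :=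
  z • 1 - w • φ z

variable {φ : ℂ → Matrix n n ℂ} {w : ℂ} {r : ℝ}

theorem analyticOnNhd_pencil {U : Set ℂ} (hU : IsOpen U) (hφ : DifferentiableOn ℂ φ U) (w : ℂ) :
    AnalyticOnNhd ℂ (pencil φ w) U :=
  DifferentiableOn.analyticOnNhd ((differentiableOn_id.smul_const 1).sub (hφ.const_smul w)) hU

theorem analyticOnNhd_det_pencil {U : Set ℂ} (hU : IsOpen U) (hφ : DifferentiableOn ℂ φ U)
    (w : ℂ) : AnalyticOnNhd ℂ (fun z => (pencil φ w z).det) U := fun z hz =>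
  analyticAt_det (analyticOnNhd_pencil hU hφ w z hz)

theorem continuousOn_uncurry_det_pencil {U : Set ℂ} (hφ : ContinuousOn φ U) :
    ContinuousOn (Function.uncurry fun w z => (pencil φ w z).det) (Set.univ ×ˢ U) := by
  have hφ' : ContinuousOn (fun p : ℂ × ℂ => φ p.2) (Set.univ ×ˢ U) :=
    hφ.comp continuousOn_snd fun _ hp => hp.2
  exact continuous_id.matrix_det.comp_continuousOn
    ((continuousOn_snd.smul continuousOn_const).sub (continuousOn_fst.smul hφ'))

theorem circleIntegral_logDeriv_pow (hr : 0 < r) (k : ℕ) :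
    (∮ z in C(0, r), logDeriv (· ^ k) z) = k * (2 * Real.pi * Complex.I) := by
  have hinv := circleIntegral.integral_sub_inv_of_mem_ball (mem_ball_self (x := (0 : ℂ)) hr)
  simp only [sub_zero] at hinv
  simp only [logDeriv_pow, div_eq_mul_inv, circleIntegral.integral_const_mul, hinv]

theorem det_pencil_ne_zero_of_mem_sphere
    (hspec : ∀ z ∈ ball (0 : ℂ) 1, spectrum ℂ (φ z) ⊆ ball 0 1) (hr : 0 < r) (hr1 : r < 1)
    (hw : ‖w‖ ≤ r) {z : ℂ} (hz : z ∈ sphere 0 r) : (pencil φ w z).det ≠ 0 := by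
  have hzr := mem_sphere_zero_iff_norm.1 hz
  exact det_smul_one_sub_smul_ne_zero (hspec z (mem_ball_zero_iff.2 (hzr.trans_lt hr1)))
    (norm_pos_iff.1 (hzr ▸ hr)) (hw.trans_eq hzr.symm)

theorem circleIntegral_logDeriv_det_pencil (hφ : DifferentiableOn ℂ φ (ball 0 1))
    (hspec : ∀ z ∈ ball (0 : ℂ) 1, spectrum ℂ (φ z) ⊆ ball 0 1) (hr : 0 < r) (hr1 : r < 1)
    (hw : ‖w‖ ≤ r) :
    (∮ z in C(0, r), logDeriv (fun z => (pencil φ w z).det) z) =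
      Fintype.card n * (2 * Real.pi * Complex.I) := by
  have : PreconnectedSpace (closedBall (0 : ℂ) r) :=
    Subtype.preconnectedSpace (convex_closedBall 0 r).isPreconnected
  let F : closedBall (0 : ℂ) r → ℂ → ℂ := fun v z => (pencil φ v z).det
  have hF : ContinuousOn F.uncurry (Set.univ ×ˢ ball 0 1) :=
    (continuousOn_uncurry_det_pencil hφ.continuousOn).comp
      (f := fun p : closedBall (0 : ℂ) r × ℂ => ((p.1 : ℂ), p.2))
      (by fun_prop) fun _ hp => ⟨trivial, hp.2⟩
  calc (∮ z in C(0, r), logDeriv (F ⟨w, mem_closedBall_zero_iff.2 hw⟩) z)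
      = ∮ z in C(0, r), logDeriv (F ⟨0, mem_closedBall_self hr.le⟩) z :=
        circleIntegral_logDeriv_eq_of_preconnectedSpace hr isOpen_ball (closedBall_subset_ball hr1)
          hF (fun v => (analyticOnNhd_det_pencil isOpen_ball hφ v).differentiableOn)
          (fun v _ => det_pencil_ne_zero_of_mem_sphere hspec hr hr1 (mem_closedBall_zero_iff.1 v.2))
          _ _
    _ = ∮ z in C(0, r), logDeriv (· ^ Fintype.card n) z := by simp [F, pencil]
    _ = Fintype.card n * (2 * Real.pi * Complex.I) := circleIntegral_logDeriv_pow hr _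

theorem sum_card_sub_rank_pencil_le (hφ : DifferentiableOn ℂ φ (ball 0 1))
    (hspec : ∀ z ∈ ball (0 : ℂ) 1, spectrum ℂ (φ z) ⊆ ball 0 1) (hw : w ∈ ball 0 1)
    {s : Finset ℂ} (hs : ↑s ⊆ ball (0 : ℂ) 1) :
    ∑ z ∈ s, (Fintype.card n - (pencil φ w z).rank) ≤ Fintype.card n := by
  obtain ⟨r, ⟨hr, hr1⟩, hsr⟩ := exists_pos_lt_subset_ball one_pos
    (insert w s).finite_toSet.isClosed (by simpa using Set.insert_subset hw hs)
  rw [Finset.coe_insert, Set.insert_subset_iff] at hsr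
  have hwr : ‖w‖ ≤ r := (mem_ball_zero_iff.1 hsr.1).le
  have hdet := analyticOnNhd_det_pencil isOpen_ball hφ w
  suffices ∑ z ∈ s, ((Fintype.card n - (pencil φ w z).rank : ℕ) : ℕ∞) ≤ Fintype.card n by
    exact_mod_cast this
  calc ∑ z ∈ s, ((Fintype.card n - (pencil φ w z).rank : ℕ) : ℕ∞)
      ≤ ∑ z ∈ s, analyticOrderAt (fun z => (pencil φ w z).det) z :=
        Finset.sum_le_sum fun z hz =>
          card_sub_rank_le_analyticOrderAt_det (analyticOnNhd_pencil isOpen_ball hφ w z (hs hz))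
    _ ≤ Fintype.card n :=
        sum_analyticOrderAt_le_of_circleIntegral_logDeriv_eq hr
          (hdet.mono (closedBall_subset_ball hr1))
          (fun _ => det_pencil_ne_zero_of_mem_sphere hspec hr hr1 hwr)
          (circleIntegral_logDeriv_det_pencil hφ hspec hr hr1 hwr)
          (hsr.2.trans ball_subset_closedBall)

theorem norm_le_of_rank_add_rank_lt (hφ : DifferentiableOn ℂ φ (ball 0 1))
    (hspec : ∀ z ∈ ball (0 : ℂ) 1, spectrum ℂ (φ z) ⊆ ball 0 1) {α t : ℂ} (hα : α ∈ ball 0 1)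
    (hrank : (φ 0).rank + (t • 1 - φ α).rank < Fintype.card n) : ‖t‖ ≤ ‖α‖ := by
  by_contra! hlt
  have ht : t ≠ 0 := norm_pos_iff.1 ((norm_nonneg α).trans_lt hlt)
  have ht' : t ∈ nonZeroDivisors ℂ := mem_nonZeroDivisors_of_ne_zero ht
  rcases eq_or_ne α 0 with rfl | hα0
  · refine hrank.not_ge ?_
    calc Fintype.card n = (φ 0 + (t • 1 - φ 0)).rank := by
          rw [add_sub_cancel, Matrix.rank_smul_of_mem_nonZeroDivisors _ ht', Matrix.rank_one]
      _ ≤ (φ 0).rank + (t • 1 - φ 0).rank := matrix_rank_add_le _ _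
  have hw : α / t ∈ ball (0 : ℂ) 1 := by
    rwa [mem_ball_zero_iff, norm_div, div_lt_one (norm_pos_iff.2 ht)]
  have hpencil0 : pencil φ (α / t) 0 = -(α / t) • φ 0 := by simp [pencil]
  have hpencilα : pencil φ (α / t) α = (α / t) • (t • 1 - φ α) := by
    rw [pencil, smul_sub, smul_smul, div_mul_cancel₀ _ ht]
  have hcount := sum_card_sub_rank_pencil_le hφ hspec hw (s := {0, α})
    (by simpa [Set.insert_subset_iff] using hα)
  have hu : α / t ∈ nonZeroDivisors ℂ := mem_nonZeroDivisors_of_ne_zero (div_ne_zero hα0 ht)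
  have hu' : -(α / t) ∈ nonZeroDivisors ℂ :=
    mem_nonZeroDivisors_of_ne_zero (neg_ne_zero.2 (div_ne_zero hα0 ht))
  rw [Finset.sum_pair hα0.symm, hpencil0, hpencilα, Matrix.rank_smul_of_mem_nonZeroDivisors _ hu',
    Matrix.rank_smul_of_mem_nonZeroDivisors _ hu] at hcount
  omega

end Pencil

section Invariants

variable {E : Type*} [NormedAddCommGroup E] [NormedSpace ℂ E]
variable {F : Type*} [NormedAddCommGroup F] [NormedSpace ℂ F]
variable {D : Set E} {G : Set F} {φ : ℂ → E} {z X : E}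

namespace IsHolomorphicDisc

theorem differentiableAt_zero (hφ : IsHolomorphicDisc D φ) : DifferentiableAt ℂ φ 0 :=
  hφ.1.differentiableAt (ball_mem_nhds 0 one_pos)

theorem comp_holomorphic (hφ : IsHolomorphicDisc D φ) {f : E → F} (hf : DifferentiableOn ℂ f D)
    (hfG : Set.MapsTo f D G) : IsHolomorphicDisc G (f ∘ φ) :=
  ⟨hf.comp hφ.1 hφ.2, hfG.comp hφ.2⟩

theorem lempertFunction_le (hφ : IsHolomorphicDisc D φ) {α : ℂ} (hα : α ∈ ball 0 1) :
    lempertFunction D (φ 0) (φ α) ≤ ‖α‖ₑ :=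
  sInf_le ⟨α, hα, rfl, φ, hφ, rfl, rfl⟩

theorem kobayashiRoyden_le (hφ : IsHolomorphicDisc D φ) (α : ℂ) :
    kobayashiRoyden D (φ 0) (α • deriv φ 0) ≤ ‖α‖ₑ :=
  sInf_le ⟨α, rfl, φ, hφ, rfl, rfl⟩

theorem eventually_perturbation (hφ : IsHolomorphicDisc D φ) (hD : IsOpen D) {c : ℂ}
    (hc : ‖c‖ < 1) :
    ∀ᶠ p : E × E in 𝓝 0, IsHolomorphicDisc D fun ζ => φ (c * ζ) + p.1 + ζ • p.2 := by
  have hmaps : Set.MapsTo (c * ·) (closedBall (0 : ℂ) 1) (ball 0 1) := fun ζ hζ => by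
    rw [mem_ball_zero_iff, norm_mul]
    exact mul_lt_one_of_nonneg_of_lt_one_left (norm_nonneg c) hc (mem_closedBall_zero_iff.1 hζ)
  have hmem : ∀ᶠ p : E × E in 𝓝 0, ∀ ζ ∈ closedBall (0 : ℂ) 1, φ (c * ζ) + p.1 + ζ • p.2 ∈ D := by
    refine (isCompact_closedBall 0 1).eventually_forall_of_forall_eventually fun ζ hζ => ?_
    have hφζ : ContinuousAt φ (c * ζ) :=
      hφ.1.continuousOn.continuousAt (isOpen_ball.mem_nhds (hmaps hζ))
    have hcont : ContinuousAt (fun q : (E × E) × ℂ => φ (c * q.2) + q.1.1 + q.2 • q.1.2) (0, ζ) :=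
      ((ContinuousAt.comp (f := fun q : (E × E) × ℂ => c * q.2) hφζ (by fun_prop)).add
        (by fun_prop)).add (by fun_prop)
    exact hcont.eventually_mem (hD.mem_nhds (by simpa using hφ.2 (hmaps hζ)))
  filter_upwards [hmem] with p hp
  have hscale : DifferentiableOn ℂ (fun ζ => φ (c * ζ)) (ball 0 1) :=
    hφ.1.comp (by fun_prop) (hmaps.mono_left ball_subset_closedBall)
  exact ⟨(hscale.add_const _).add (by fun_prop), fun ζ hζ => hp ζ (ball_subset_closedBall hζ)⟩

end IsHolomorphicDisc

theorem lempertFunction_map_le {f : E → F} (hf : DifferentiableOn ℂ f D) (hfG : Set.MapsTo f D G)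
    (z w : E) : lempertFunction G (f z) (f w) ≤ lempertFunction D z w := by
  refine le_sInf ?_
  rintro _ ⟨α, hα, rfl, φ, hφ, rfl, rfl⟩
  exact (hφ.comp_holomorphic hf hfG).lempertFunction_le hα

theorem kobayashiRoyden_map_le {f : E → F} {f' : E →L[ℂ] F} (hf : DifferentiableOn ℂ f D)
    (hfG : Set.MapsTo f D G) (hf' : HasFDerivAt f f' z) (X : E) :
    kobayashiRoyden G (f z) (f' X) ≤ kobayashiRoyden D z X := by
  refine le_sInf ?_
  rintro _ ⟨α, rfl, φ, hφ, rfl, rfl⟩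
  have hderiv := (hf'.comp_hasDerivAt 0 hφ.differentiableAt_zero.hasDerivAt).deriv
  rw [map_smul, ← hderiv]
  exact (hφ.comp_holomorphic hf hfG).kobayashiRoyden_le α

theorem kobayashiRoyden_le_one (h : ∀ ζ ∈ ball (0 : ℂ) 1, z + ζ • X ∈ D) :
    kobayashiRoyden D z X ≤ 1 := by
  have hdisc : IsHolomorphicDisc D fun ζ => z + ζ • X := ⟨by fun_prop, h⟩
  have hderiv : HasDerivAt (fun ζ : ℂ => z + ζ • X) X 0 := by
    simpa only [id, one_smul] using ((hasDerivAt_id (0 : ℂ)).smul_const X).const_add z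
  simpa only [hderiv.deriv, zero_smul, add_zero, one_smul, enorm_one] using
    hdisc.kobayashiRoyden_le 1

theorem tendsto_inv_smul_sub_nhds_smul_deriv {𝕜 V : Type*} [NontriviallyNormedField 𝕜]
    [NormedAddCommGroup V] [NormedSpace 𝕜 V] {f : 𝕜 → V} (hf : DifferentiableAt 𝕜 f 0) (a : 𝕜) :
    Tendsto (fun t => t⁻¹ • (f (a * t) - f 0)) (𝓝[≠] 0) (𝓝 (a • deriv f 0)) := by
  have hfa : HasDerivAt (fun t => f (a * t)) (a • deriv f 0) 0 := by
    simpa [Function.comp_def] using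
      HasDerivAt.scomp_of_eq 0 hf.hasDerivAt ((hasDerivAt_id 0).const_mul a) (by simp)
  simpa using hfa.tendsto_slope_zero

theorem lempertDerivative_smul_deriv_le (hφ : IsHolomorphicDisc D φ) (hD : IsOpen D) {α β : ℂ}
    (hαβ : ‖α‖ < ‖β‖) : lempertDerivative D (φ 0) (α • deriv φ 0) ≤ ‖β‖ₑ := by
  have hβ : β ≠ 0 := norm_pos_iff.1 ((norm_nonneg α).trans_lt hαβ)
  have hc : ‖α / β‖ < 1 := by rwa [norm_div, div_lt_one (norm_pos_iff.2 hβ)]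
  set l := 𝓝[≠] (0 : ℂ) ×ˢ (𝓝 (φ 0) ×ˢ 𝓝 (α • deriv φ 0))
  have ht : Tendsto Prod.fst l (𝓝[≠] 0) := tendsto_fst
  have hz : Tendsto (fun p : ℂ × E × E => p.2.1 - φ 0) l (𝓝 0) := by
    simpa using tendsto_sub_nhds_zero_iff.2 (tendsto_fst.comp tendsto_snd)
  have hv : Tendsto (fun p : ℂ × E × E => β⁻¹ • (p.2.2 - p.1⁻¹ • (φ (α * p.1) - φ 0))) l (𝓝 0) := by
    simpa using ((tendsto_snd.comp tendsto_snd).sub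
      ((tendsto_inv_smul_sub_nhds_smul_deriv hφ.differentiableAt_zero α).comp ht)).const_smul β⁻¹
  have hβt : Tendsto (fun p : ℂ × E × E => β * p.1) l (𝓝 0) := by
    simpa using (ht.mono_right nhdsWithin_le_nhds).const_mul β
  refine limsup_le_of_le (h := ?_)
  filter_upwards [(hz.prodMk_nhds hv).eventually (hφ.eventually_perturbation hD hc),
    hβt.eventually (ball_mem_nhds 0 one_pos), ht.eventually self_mem_nhdsWithin]
    with ⟨t, z', X'⟩ hχ hβt ht0
  have hend : φ (α / β * (β * t)) + (z' - φ 0) +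
      (β * t) • β⁻¹ • (X' - t⁻¹ • (φ (α * t) - φ 0)) = z' + t • X' := by
    rw [← mul_assoc, div_mul_cancel₀ _ hβ, smul_smul, mul_right_comm, mul_inv_cancel₀ hβ, one_mul,
      smul_sub, smul_inv_smul₀ ht0]
    abel
  have hle := hχ.lempertFunction_le hβt
  rw [hend, mul_zero, zero_smul, add_zero, add_sub_cancel, enorm_mul] at hle
  exact ENNReal.div_le_of_le_mul hle

theorem lempertDerivative_le_kobayashiRoyden (hD : IsOpen D) (z X : E) :
    lempertDerivative D z X ≤ kobayashiRoyden D z X := by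
  refine le_sInf ?_
  rintro _ ⟨α, rfl, φ, hφ, rfl, rfl⟩
  refine ENNReal.le_of_forall_pos_le_add fun ε hε _ => ?_
  have hβ : ‖((‖α‖ + ε : ℝ) : ℂ)‖ = ‖α‖ + ε := by
    rw [Complex.norm_real, Real.norm_of_nonneg (by positivity)]
  calc lempertDerivative D (φ 0) (α • deriv φ 0)
      ≤ ‖((‖α‖ + ε : ℝ) : ℂ)‖ₑ :=
        lempertDerivative_smul_deriv_le hφ hD (by rwa [hβ, lt_add_iff_pos_right])
    _ = ‖α‖ₑ + ε := by
      rw [← ofReal_norm, hβ, ENNReal.ofReal_add (norm_nonneg α) ε.coe_nonneg, ofReal_norm,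
        ENNReal.ofReal_coe_nnreal]

section Curve

variable {Y : ℂ → E} {c : ℝ≥0∞}

theorem limsup_lempertFunction_div_le (hY : Tendsto Y (𝓝[≠] 0) (𝓝 X)) :
    limsup (fun t : ℂ => lempertFunction D z (z + t • Y t) / ‖t‖ₑ) (𝓝[≠] 0) ≤
      lempertDerivative D z X := by
  have hcurve : Tendsto (fun t => (t, z, Y t)) (𝓝[≠] (0 : ℂ)) (𝓝[≠] 0 ×ˢ (𝓝 z ×ˢ 𝓝 X)) :=
    tendsto_id.prodMk (tendsto_const_nhds.prodMk hY)
  exact limsup_le_limsup_of_le (f := map (fun t => (t, z, Y t)) (𝓝[≠] 0)) hcurve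
    (u := fun p : ℂ × E × E => lempertFunction D p.2.1 (p.2.1 + p.1 • p.2.2) / ‖p.1‖ₑ)

theorem le_lempertDerivative (hY : Tendsto Y (𝓝[≠] 0) (𝓝 X))
    (hc : ∃ᶠ t in 𝓝[≠] (0 : ℂ), c ≤ lempertFunction D z (z + t • Y t) / ‖t‖ₑ) :
    c ≤ lempertDerivative D z X :=
  (le_limsup_of_frequently_le hc).trans (limsup_lempertFunction_div_le hY)

theorem tendsto_lempertFunction_div (hY : Tendsto Y (𝓝[≠] 0) (𝓝 X))
    (hc : ∀ᶠ t in 𝓝[≠] (0 : ℂ), c ≤ lempertFunction D z (z + t • Y t) / ‖t‖ₑ)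
    (hD : lempertDerivative D z X ≤ c) :
    Tendsto (fun t : ℂ => lempertFunction D z (z + t • Y t) / ‖t‖ₑ) (𝓝[≠] 0) (𝓝 c) :=
  tendsto_of_le_liminf_of_limsup_le (le_liminf_of_le (h := hc))
    ((limsup_lempertFunction_div_le hY).trans hD)

end Curve

end Invariants

section SpectralBall

theorem exists_eq_diag_of_mem_spectrum {R m : Type*} [Field R] [Fintype m] [LinearOrder m]
    {M : Matrix m m R} (hM : M.IsUpperTriangular) {μ : R} (hμ : μ ∈ spectrum R M) :
    ∃ i, μ = M i i := by
  rw [Matrix.mem_spectrum_iff_isRoot_charpoly, Matrix.charpoly_of_isUpperTriangular M hM,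
    Polynomial.isRoot_prod] at hμ
  obtain ⟨i, -, hi⟩ := hμ
  exact ⟨i, (Polynomial.root_X_sub_C.1 hi).symm⟩

theorem isOpen_setOf_spectrum_subset {n : Type*} [Fintype n] [DecidableEq n] {U : Set ℂ}
    (hU : IsOpen U) : IsOpen {M : Matrix n n ℂ | spectrum ℂ M ⊆ U} := by
  let L := (Matrix.toEuclideanCLM (n := n) (𝕜 := ℂ)).toAlgEquiv
  have hL : Continuous L := L.toLinearMap.continuous_of_finiteDimensional
  have hopen : IsOpen {T : EuclideanSpace ℂ n →L[ℂ] EuclideanSpace ℂ n | spectrum ℂ T ⊆ U} :=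
    upperHemicontinuous_iff_isOpen_preimage_Iic.1 (upperHemicontinuous_spectrum ℂ _) U hU
  simpa only [Set.preimage_ofPred_eq, AlgEquiv.spectrum_eq] using hopen.preimage hL

theorem isOpen_spectralBall : IsOpen spectralBall :=
  isOpen_setOf_spectrum_subset isOpen_ball

theorem isOpen_tracelessSpectralBall : IsOpen tracelessSpectralBall :=
  isOpen_spectralBall.preimage continuous_subtype_val

theorem mapsTo_subtypeL_tracelessSpectralBall :
    Set.MapsTo TracelessMatrix.subtypeL tracelessSpectralBall spectralBall := fun _ h => h

theorem kobayashiRoyden_spectralBall_le (z X : TracelessMatrix) :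
    kobayashiRoyden spectralBall (z : Matrix (Fin 3) (Fin 3) ℂ) X ≤
      kobayashiRoyden tracelessSpectralBall z X :=
  kobayashiRoyden_map_le TracelessMatrix.subtypeL.differentiable.differentiableOn
    mapsTo_subtypeL_tracelessSpectralBall TracelessMatrix.subtypeL.hasFDerivAt X

theorem lempertFunction_spectralBall_le (z w : TracelessMatrix) :
    lempertFunction spectralBall (z : Matrix (Fin 3) (Fin 3) ℂ) w ≤
      lempertFunction tracelessSpectralBall z w :=
  lempertFunction_map_le TracelessMatrix.subtypeL.differentiable.differentiableOn
    mapsTo_subtypeL_tracelessSpectralBall z w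

theorem isPrimitiveRoot_cubeRoot : IsPrimitiveRoot cubeRoot 3 := by
  simpa [cubeRoot] using Complex.isPrimitiveRoot_exp 3 (by norm_num)

theorem cubeRoot_sub_one_mul_cubeRoot_sq_sub_one : (cubeRoot - 1) * (cubeRoot ^ 2 - 1) = 3 := by
  have hsum : 1 + cubeRoot + cubeRoot ^ 2 = 0 := by
    simpa [Finset.sum_range_succ] using isPrimitiveRoot_cubeRoot.geom_sum_eq_zero (by norm_num)
  linear_combination isPrimitiveRoot_cubeRoot.pow_eq_one - hsum

theorem matA_add_smul_matB_zero_mem_spectralBall {ζ : ℂ} (hζ : ζ ∈ ball 0 1) :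
    matA + ζ • matB 0 ∈ spectralBall := by
  intro μ hμ
  have htri : (matA + ζ • matB 0).IsUpperTriangular := by
    intro i j hij
    fin_cases i <;> fin_cases j <;> simp_all [matA, matB]
  obtain ⟨i, rfl⟩ := exists_eq_diag_of_mem_spectrum htri hμ
  have hdiag : ‖(matA + ζ • matB 0) i i‖ = ‖ζ‖ := by
    fin_cases i <;> simp [matA, matB, isPrimitiveRoot_cubeRoot.norm'_eq_one three_ne_zero]
  rwa [mem_ball_zero_iff, hdiag, ← mem_ball_zero_iff]

theorem kobayashiRoyden_tracelessSpectralBall_le_one :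
    kobayashiRoyden tracelessSpectralBall tracelessA tracelessB ≤ 1 :=
  kobayashiRoyden_le_one fun _ => matA_add_smul_matB_zero_mem_spectralBall

theorem rank_matA_le_one : matA.rank ≤ 1 := by
  have hA : matA = Matrix.vecMulVec ![0, 1, 0] ![0, 0, 1] := by
    ext i j
    fin_cases i <;> fin_cases j <;> simp [matA, Matrix.vecMulVec_apply]
  exact hA ▸ Matrix.rank_vecMulVec_le _ _

theorem rank_smul_one_sub_matA_add_smul_matB_le_one (t : ℂ) :
    (t • 1 - (matA + t • matB t)).rank ≤ 1 := by
  have hB : t • 1 - (matA + t • matB t) =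
      Matrix.vecMulVec ![0, 1, (cubeRoot ^ 2 - 1) * t] ![0, (1 - cubeRoot) * t, -1] := by
    ext i j
    fin_cases i <;> fin_cases j <;> simp [matA, matB, Matrix.vecMulVec_apply]
    · ring
    · linear_combination t ^ 2 * cubeRoot_sub_one_mul_cubeRoot_sq_sub_one
    · ring
  exact hB ▸ Matrix.rank_vecMulVec_le _ _

theorem enorm_le_lempertFunction_spectralBall (t : ℂ) :
    ‖t‖ₑ ≤ lempertFunction spectralBall matA (matA + t • matB t) := by
  refine le_sInf ?_
  rintro _ ⟨α, hα, rfl, φ, hφ, h0, hαt⟩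
  refine enorm_le_iff_norm_le.2 (norm_le_of_rank_add_rank_lt hφ.1 hφ.2 hα ?_)
  rw [h0, hαt]
  calc matA.rank + (t • 1 - (matA + t • matB t)).rank
      ≤ 1 + 1 := add_le_add rank_matA_le_one (rank_smul_one_sub_matA_add_smul_matB_le_one t)
    _ < Fintype.card (Fin 3) := by simp

theorem one_le_lempertFunction_spectralBall_div {t : ℂ} (ht : t ≠ 0) :
    1 ≤ lempertFunction spectralBall matA (matA + t • matB t) / ‖t‖ₑ := by
  rw [ENNReal.le_div_iff_mul_le (Or.inl (by simpa using ht)) (Or.inl enorm_ne_top), one_mul]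
  exact enorm_le_lempertFunction_spectralBall t

theorem tendsto_matB : Tendsto matB (𝓝[≠] 0) (𝓝 (matB 0)) := by
  have hB : matB = fun t => matB 0 + t • Matrix.single 2 1 3 := by
    ext t i j
    fin_cases i <;> fin_cases j <;> simp [matB, mul_comm]
  have hcont : Continuous matB := by
    rw [hB]
    fun_prop
  exact hcont.continuousWithinAt

theorem one_le_lempertDerivative_spectralBall : 1 ≤ lempertDerivative spectralBall matA (matB 0) :=
  le_lempertDerivative tendsto_matB <| Eventually.frequently <|
    eventually_mem_nhdsWithin.mono fun _ => one_le_lempertFunction_spectralBall_div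

theorem one_le_lempertDerivative_tracelessSpectralBall :
    1 ≤ lempertDerivative tracelessSpectralBall tracelessA tracelessB := by
  let Y : ℂ → TracelessMatrix := fun t => ⟨matB t, matB_traceless t⟩
  have hY : Tendsto Y (𝓝[≠] 0) (𝓝 tracelessB) := tendsto_subtype_rng.2 tendsto_matB
  refine le_lempertDerivative hY (Eventually.frequently ?_)
  filter_upwards [self_mem_nhdsWithin] with t ht
  calc 1 ≤ lempertFunction spectralBall matA (matA + t • matB t) / ‖t‖ₑ :=
        one_le_lempertFunction_spectralBall_div ht
    _ ≤ lempertFunction tracelessSpectralBall tracelessA (tracelessA + t • Y t) / ‖t‖ₑ :=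
        ENNReal.div_le_div_right
          (lempertFunction_spectralBall_le tracelessA (tracelessA + t • Y t)) _

end SpectralBall

theorem mainTheorem2 :
    (kobayashiRoyden tracelessSpectralBall tracelessA tracelessB = 1 ∧
      Tendsto (fun t : ℂ => lempertFunction spectralBall matA (matA + t • matB t) / ‖t‖ₑ)
        (𝓝[≠] 0) (𝓝 1)) ∧
    kobayashiRoyden spectralBall matA (matB 0) = 1 ∧
    lempertDerivative tracelessSpectralBall tracelessA tracelessB = 1 ∧
    lempertDerivative spectralBall matA (matB 0) = 1 := by
  have hκ' := kobayashiRoyden_tracelessSpectralBall_le_one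
  have hκ : kobayashiRoyden spectralBall matA (matB 0) ≤ 1 :=
    (kobayashiRoyden_spectralBall_le tracelessA tracelessB).trans hκ'
  have hl := one_le_lempertDerivative_spectralBall
  have hl' := one_le_lempertDerivative_tracelessSpectralBall
  have hlκ := lempertDerivative_le_kobayashiRoyden isOpen_spectralBall matA (matB 0)
  have hlκ' :=
    lempertDerivative_le_kobayashiRoyden isOpen_tracelessSpectralBall tracelessA tracelessB
  refine ⟨⟨le_antisymm hκ' (hl'.trans hlκ'), ?_⟩, le_antisymm hκ (hl.trans hlκ),
    le_antisymm (hlκ'.trans hκ') hl', le_antisymm (hlκ.trans hκ) hl⟩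
  exact tendsto_lempertFunction_div tendsto_matB
    (eventually_mem_nhdsWithin.mono fun _ => one_le_lempertFunction_spectralBall_div)
    (hlκ.trans hκ)
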